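/- Let $\mathfrak m$ be an uncountable cardinal with $\sup\{\mathfrak m^{\mathfrak n} : \mathfrak n<\mathfrak m\}=\mathfrak m$. Let $\mathbb U_{\mathfrak m}$ be the Urysohn–Katětov universal metric space of weight $\mathfrak m$, i.e. the metric space, unique up to isometry, which has weight $\mathfrak m$, contains an isometric copy of every metric space of weight $\le\mathfrak m$, and is such that every isometry between two subsets of cardinality $<\mathfrak m$ extends to an isometry of the whole space onto itself. Let $\mathrm{Iso}(\mathbb U_{\mathfrak m})$ be the group of all isometries of $\mathbb U_{\mathfrak m}$ onto itself, with the topology of pointwise convergence. Let $G$ be a subgroup of $\mathrm{Iso}(\mathbb U_{\mathfrak m})$, with the induced topology, which has a dense subset of cardinality $<\mathfrak m$ and has property (OB): every continuous left-invariant pseudometric on $G$ is bounded. Then $G$ is FSIN: a function $f:G\to\mathbb R$ (bounded or not) is left uniformly continuous if and only if it is right uniformly continuous. In particular, every bounded left uniformly continuous real function on $G$ is right uniformly continuous. Here $f$ is left (respectively right) uniformly continuous if for every $\varepsilon>0$ there is a neighbourhood $V$ of the identity in $G$ such that $|f(x)-f(y)|<\varepsilon$ whenever $x^{-1}y\in V$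 (respectively $xy^{-1}\in V$). -/

import Mathlib

open Topology Cardinal

universe u

/-- The weight of a topological space: the least cardinality of a base. -/
noncomputable def topWeight (X : Type*) [TopologicalSpace X] : Cardinal :=
  sInf {c | ∃ B : Set (Set X), TopologicalSpace.IsTopologicalBasis B ∧ #B = c}

/-- The density of a topological space: the least cardinality of a dense subset. -/
noncomputable def topDensity (X : Type*) [TopologicalSpace X] : Cardinal :=
  sInf {c | ∃ A : Set X, Dense A ∧ #A = c}

/-- `X` is `τ`-homogeneous: every isometry between two subsets of cardinality `< τ` extends to
an isometry of `X` onto itself. -/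
def IsHomogeneousSpace (τ : Cardinal) (X : Type*) [MetricSpace X] : Prop :=
  ∀ (A B : Set X), #A < τ → #B < τ → ∀ f : A ≃ᵢ B, ∃ g : X ≃ᵢ X, ∀ a : A, g a = f a

/-- `X` is strongly `τ`-universal: every metric space of weight `≤ τ` embeds isometrically
into `X`. -/
def IsStronglyUniversal (τ : Cardinal.{u}) (X : Type u) [MetricSpace X] : Prop :=
  ∀ (Y : Type u) [MetricSpace Y], topWeight Y ≤ τ → ∃ i : Y → X, Isometry i

/-- `X` is the Urysohn–Katětov universal space of weight `τ`. -/
structure IsUrysohnSpace (τ : Cardinal.{u}) (X : Type u) [MetricSpace X] : Prop where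
  weight_eq : topWeight X = τ
  homogeneous : IsHomogeneousSpace τ X
  universal : IsStronglyUniversal τ X

/-- The topology of pointwise convergence on the group of isometries of `X` onto itself. -/
instance isometryGroupTopology (X : Type*) [MetricSpace X] : TopologicalSpace (X ≃ᵢ X) :=
  TopologicalSpace.induced (fun g : X ≃ᵢ X => (g : X → X)) inferInstance

theorem continuous_isometry_eval (X : Type*) [MetricSpace X] (x : X) :
    Continuous (fun g : X ≃ᵢ X => g x) :=
  (continuous_apply x).comp continuous_induced_dom

/-- The topology of pointwise convergence makes the isometry group a topological group. -/
instance isometryGroup_isTopologicalGroup (X : Type*) [MetricSpace X] :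
    IsTopologicalGroup (X ≃ᵢ X) where
  continuous_mul := by
    refine continuous_induced_rng.2 (continuous_pi fun x => ?_)
    rw [continuous_iff_continuousAt]
    rintro ⟨g, h⟩
    have h1 : Filter.Tendsto (fun p : (X ≃ᵢ X) × (X ≃ᵢ X) => dist (p.2 x) (h x) +
        dist (p.1 (h x)) (g (h x))) (𝓝 (g, h)) (𝓝 0) := by
      have hc : Continuous (fun p : (X ≃ᵢ X) × (X ≃ᵢ X) => dist (p.2 x) (h x) +
          dist (p.1 (h x)) (g (h x))) :=
        ((((continuous_isometry_eval X x).comp continuous_snd).dist continuous_const).add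
          (((continuous_isometry_eval X (h x)).comp continuous_fst).dist continuous_const))
      simpa using hc.tendsto (g, h)
    refine tendsto_iff_dist_tendsto_zero.2 (squeeze_zero (fun _ => dist_nonneg) ?_ h1)
    rintro ⟨p, q⟩
    calc dist (p (q x)) (g (h x)) ≤ dist (p (q x)) (p (h x)) + dist (p (h x)) (g (h x)) :=
          dist_triangle _ _ _
      _ = dist (q x) (h x) + dist (p (h x)) (g (h x)) := by rw [p.dist_eq]
  continuous_inv := by
    refine continuous_induced_rng.2 (continuous_pi fun x => ?_)
    rw [continuous_iff_continuousAt]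
    intro g
    have h1 : Filter.Tendsto (fun p : X ≃ᵢ X => dist (g (g⁻¹ x)) (p (g⁻¹ x))) (𝓝 g) (𝓝 0) := by
      have hc : Continuous (fun p : X ≃ᵢ X => dist (g (g⁻¹ x)) (p (g⁻¹ x))) :=
        continuous_const.dist (continuous_isometry_eval X (g⁻¹ x))
      simpa using hc.tendsto g
    refine tendsto_iff_dist_tendsto_zero.2 (squeeze_zero (fun _ => dist_nonneg) ?_ h1)
    intro p
    change dist (p⁻¹ x) (g⁻¹ x) ≤ _
    rw [← p.dist_eq, IsometryEquiv.apply_inv_self, IsometryEquiv.apply_inv_self]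

/-- A left-invariant continuous pseudometric on a topological group. -/
structure IsLeftInvariantPseudometric {G : Type*} [Group G] [TopologicalSpace G]
    (ρ : G → G → ℝ) : Prop where
  nonneg : ∀ x y, 0 ≤ ρ x y
  self : ∀ x, ρ x x = 0
  symm : ∀ x y, ρ x y = ρ y x
  triangle : ∀ x y z, ρ x y ≤ ρ x z + ρ z y
  left_inv : ∀ a x y, ρ (a * x) (a * y) = ρ x y
  continuous : Continuous (fun p : G × G => ρ p.1 p.2)

/-- Property (OB): every continuous left-invariant pseudometric is bounded. -/
def HasPropertyOB (G : Type*) [Group G] [TopologicalSpace G] : Prop :=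
  ∀ ρ : G → G → ℝ, IsLeftInvariantPseudometric ρ → ∃ C : ℝ, ∀ x y, ρ x y ≤ C

/-- Uniform continuity for the left uniform structure of `G`. -/
def LeftUniformlyContinuous {G : Type*} [Group G] [TopologicalSpace G] (f : G → ℝ) : Prop :=
  ∀ ε > 0, ∃ V ∈ 𝓝 (1 : G), ∀ x y : G, x⁻¹ * y ∈ V → |f x - f y| < ε

/-- Uniform continuity for the right uniform structure of `G`. -/
def RightUniformlyContinuous {G : Type*} [Group G] [TopologicalSpace G] (f : G → ℝ) : Prop :=
  ∀ ε > 0, ∃ V ∈ 𝓝 (1 : G), ∀ x y : G, x * y⁻¹ ∈ V → |f x - f y| < ε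

/-- `G` is FSIN: the left and the right uniformly continuous real-valued functions on `G`
(bounded or not) are the same. -/
def IsFSIN (G : Type*) [Group G] [TopologicalSpace G] : Prop :=
  ∀ f : G → ℝ, LeftUniformlyContinuous f ↔ RightUniformlyContinuous f

/-!
The proof rests on one property of `U`: a Katětov function on a set of cardinality `< m` is the
distance to some point of `U` (`IsUrysohnSpace.exists_dist_eq`). As `G` has a dense subset of
cardinality `< m`, distances to countably many whole `G`-orbits can be prescribed as well
(`IsUrysohnSpace.exists_dist_orbit_eq`). If `dist z (g y) = φ g` for all `g`, then
`|φ (v * g) - φ g| ≤ dist (v z) z`, which is small for all `g` at once when `v` is near the identity.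
So every function on `G` that can be realized by such a distance is right uniformly continuous. By
property (OB) orbits are bounded, so bounded functions that are Lipschitz for an orbit pseudometric
become Katětov after adding a constant.

Orbit pseudometrics `(g, h) ↦ dist (g x) (h x)` are directed (`exists_dominating_pair`), so a left
uniformly continuous `F` is uniformly continuous for one of them. To treat unbounded `F`, all of its
level sets have to be controlled by a single neighbourhood of the identity. For `F ≥ 0`, the
truncated distances to the sets `{F < k ε}`, for natural numbers `k`, form an antitone sequence of
Lipschitz functions. This sequence is placed on the orbits of points `y k` with
`dist (y k) (g x) = k δ + dist x (g x)`; antitonicity makes the resulting function on the union of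
these orbits Katětov, and a single point `z` realizes it (`exists_nhds_forall_abs_sub_lt`). A general
`F` is a difference of nonnegative ones, and inversion gives the converse implication.
-/

/-! ### Realization of Katětov functions -/

theorem topWeight_le_mk_mul_aleph0 (Y : Type u) [MetricSpace Y] : topWeight Y ≤ #Y * ℵ₀ := by
  let b : Y × ℕ → Set Y := fun p => Metric.ball p.1 (1 / ((p.2 : ℝ) + 1))
  have hb : TopologicalSpace.IsTopologicalBasis (Set.range b) := by
    refine TopologicalSpace.isTopologicalBasis_of_isOpen_of_nhds ?_ ?_
    · rintro _ ⟨p, rfl⟩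
      exact Metric.isOpen_ball
    · intro a s ha hs
      obtain ⟨ε, hε, hsub⟩ := Metric.isOpen_iff.1 hs a ha
      obtain ⟨n, hn⟩ := exists_nat_one_div_lt hε
      exact ⟨_, ⟨(a, n), rfl⟩, Metric.mem_ball_self Nat.one_div_pos_of_nat,
        (Metric.ball_subset_ball hn.le).trans hsub⟩
  have h1 : topWeight Y ≤ #(Set.range b) := csInf_le' ⟨_, hb, rfl⟩
  have h2 : #(Set.range b) ≤ #(Y × ℕ) := Cardinal.mk_range_le
  exact h1.trans (h2.trans (by simp))

/-- One-point metric extension of `A` by a point at distance `φ a` from each `a : A`. -/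
@[reducible] def katetovExtension {A : Type u} [MetricSpace A] (φ : A → ℝ) (hpos : ∀ a, 0 < φ a)
    (hlip : ∀ a b, φ a - φ b ≤ dist a b) (hsum : ∀ a b, dist a b ≤ φ a + φ b) :
    MetricSpace (Option A) where
  dist p q := match p, q with
    | none, none => 0
    | none, some a => φ a
    | some a, none => φ a
    | some a, some b => dist a b
  dist_self p := by cases p <;> simp
  dist_comm p q := by cases p <;> cases q <;> simp [dist_comm]
  dist_triangle p q r := by
    rcases p with _ | a <;> rcases q with _ | b <;> rcases r with _ | c <;> simp only
    · simp
    · simp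
    · linarith [hpos b]
    · linarith [hlip c b, dist_comm b c]
    · simp
    · exact hsum a c
    · linarith [hlip a b]
    · exact dist_triangle a b c
  eq_of_dist_eq_zero {p q} h := by
    rcases p with _ | a <;> rcases q with _ | b
    · rfl
    · exact absurd h (hpos b).ne'
    · exact absurd h (hpos a).ne'
    · exact congrArg some (eq_of_dist_eq_zero h)

namespace IsUrysohnSpace

variable {m : Cardinal.{u}} {U : Type u} [MetricSpace U]

/-- Every Katětov function on a small subset is the distance to a point: universality embeds the
one-point extension, and homogeneity moves the copy of the subset back onto the subset itself. -/
theorem exists_dist_eq (hU : IsUrysohnSpace m U) (hm : ℵ₀ < m) (A : Set U) (hA : #A < m)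
    (φ : A → ℝ) (hlip : ∀ a b, φ a - φ b ≤ dist a b) (hsum : ∀ a b, dist a b ≤ φ a + φ b) :
    ∃ y : U, ∀ a : A, dist y a = φ a := by
  by_cases hz : ∃ a, φ a = 0
  -- A zero of `φ` is itself the required point; otherwise `φ` is positive, as a metric demands.
  · obtain ⟨a, ha⟩ := hz
    refine ⟨a, fun b => le_antisymm ?_ ?_⟩
    · simpa [ha, Subtype.dist_eq] using hsum a b
    · have := hlip b a
      rw [ha, sub_zero, dist_comm] at this
      exact this
  · have hpos : ∀ a, 0 < φ a := fun a => by
      have h0 : 0 ≤ φ a := by linarith [hsum a a, dist_self a]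
      exact lt_of_le_of_ne h0 fun h => hz ⟨a, h.symm⟩
    let _ : MetricSpace (Option A) := katetovExtension φ hpos hlip hsum
    have hw : topWeight (Option A) ≤ m := by
      refine (topWeight_le_mk_mul_aleph0 _).trans (Cardinal.mul_lt_of_lt hm.le ?_ hm).le
      rw [Cardinal.mk_option]
      exact Cardinal.add_lt_of_lt hm.le hA (Cardinal.one_lt_aleph0.trans hm)
    obtain ⟨i, hi⟩ := hU.universal (Option A) hw
    have hs : Isometry fun a : A => i (some a) :=
      Isometry.of_dist_eq fun a b => hi.dist_eq (some a) (some b)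
    have hc : #(Set.range fun a : A => i (some a)) < m := Cardinal.mk_range_le.trans_lt hA
    obtain ⟨g, hg⟩ := hU.homogeneous _ A hc hA hs.isometryEquivOnRange.symm
    refine ⟨g (i none), fun a => ?_⟩
    have h1 := hg (hs.isometryEquivOnRange a)
    rw [IsometryEquiv.symm_apply_apply] at h1
    rw [← h1, g.dist_eq]
    exact hi.dist_eq none (some a)

variable {G : Subgroup (U ≃ᵢ U)}

/-- Prescribing distances to countably many full `G`-orbits. The orbits may be large, but the
distances are already determined on the translates by a small dense subset of `G`. -/
theorem exists_dist_orbit_eq (hU : IsUrysohnSpace m U) (hm : ℵ₀ < m) (hdens : topDensity G < m)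
    {I : Type} [Countable I] (a : I → U) (φ : I → G → ℝ)
    (hlip : ∀ i j (g h : G), φ i g - φ j h ≤ dist (g.1 (a i)) (h.1 (a j)))
    (hsum : ∀ i j (g h : G), dist (g.1 (a i)) (h.1 (a j)) ≤ φ i g + φ j h) :
    ∃ y : U, ∀ i (g : G), dist y (g.1 (a i)) = φ i g := by
  obtain ⟨Q, hQ, hQc⟩ : topDensity G ∈ {c | ∃ A : Set G, Dense A ∧ #A = c} :=
    csInf_mem ⟨_, Set.univ, dense_univ, rfl⟩
  let t : I × Q → U := fun p => p.2.1.1 (a p.1)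
  have hA : #(Set.range t) < m := by
    refine (Cardinal.mk_range_le (f := t)).trans_lt ?_
    rw [Cardinal.mk_prod]
    refine Cardinal.mul_lt_of_lt hm.le (lt_of_le_of_lt ?_ hm) ?_
    · simp
    · rw [Cardinal.lift_id', hQc]
      exact hdens
  choose s hs using fun b : Set.range t => b.2
  obtain ⟨y, hy⟩ := hU.exists_dist_eq hm (Set.range t) hA (fun b => φ (s b).1 (s b).2)
    (fun b c => by
      have := hlip (s b).1 (s c).1 (s b).2 (s c).2
      rwa [show dist b c = dist (t (s b)) (t (s c)) by rw [hs, hs]; rfl])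
    (fun b c => by
      have := hsum (s b).1 (s c).1 (s b).2 (s c).2
      rwa [show dist b c = dist (t (s b)) (t (s c)) by rw [hs, hs]; rfl])
  refine ⟨y, fun i g => ?_⟩
  have hev : ∀ x : U, Continuous fun g : G => g.1 x := fun x =>
    (continuous_isometry_eval U x).comp continuous_subtype_val
  have hφ : Continuous (φ i) := by
    rw [continuous_iff_continuousAt]
    intro g
    have h0 : Filter.Tendsto (fun h : G => dist (h.1 (a i)) (g.1 (a i))) (𝓝 g) (𝓝 0) := by
      simpa using ((hev (a i)).dist (continuous_const (y := g.1 (a i)))).tendsto g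
    refine tendsto_iff_dist_tendsto_zero.2 (squeeze_zero (fun _ => dist_nonneg) (fun h => ?_) h0)
    rw [Real.dist_eq, abs_le]
    constructor <;> linarith [hlip i i h g, hlip i i g h, dist_comm (h.1 (a i)) (g.1 (a i))]
  refine congrFun (Continuous.ext_on hQ (continuous_const.dist (hev (a i))) hφ fun q hq => ?_) g
  -- The chosen representative of `q • a i` gives the same value, as it lies at distance zero.
  let b : Set.range t := ⟨t (i, ⟨q, hq⟩), Set.mem_range_self _⟩
  have hb : t (s b) = q.1 (a i) := hs b
  have h1 := hlip (s b).1 i (s b).2 q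
  have h2 := hlip i (s b).1 q (s b).2
  change _ ≤ dist (t (s b)) _ at h1
  change _ ≤ dist _ (t (s b)) at h2
  rw [hb, dist_self] at h1 h2
  exact (hy b).trans (by linarith)

end IsUrysohnSpace

/-! ### Orbit pseudometrics -/

section Orbits

variable {U : Type u} [MetricSpace U] {G : Subgroup (U ≃ᵢ U)}

theorem isLeftInvariantPseudometric_orbit (x : U) :
    IsLeftInvariantPseudometric fun g h : G => dist (g.1 x) (h.1 x) where
  nonneg _ _ := dist_nonneg
  self _ := dist_self _
  symm _ _ := dist_comm _ _
  triangle _ _ _ := dist_triangle _ _ _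
  left_inv a g h := a.1.dist_eq (g.1 x) (h.1 x)
  continuous :=
    (((continuous_isometry_eval U x).comp continuous_subtype_val).comp continuous_fst).dist
      (((continuous_isometry_eval U x).comp continuous_subtype_val).comp continuous_snd)

theorem dist_apply_apply_eq_dist_inv_mul (g h : G) (x y : U) :
    dist (g.1 x) (h.1 y) = dist x ((g⁻¹ * h).1 y) := by
  rw [← g.1.dist_eq x]
  congr 1
  change h.1 y = g.1 (g.1⁻¹ (h.1 y))
  rw [IsometryEquiv.apply_inv_self]

variable {m : Cardinal.{u}}

namespace IsUrysohnSpace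

/-- A point at distance `c + dist x a` from every point `a` of the orbits of `x` and of `w`. -/
theorem exists_dist_eq_add (hU : IsUrysohnSpace m U) (hm : ℵ₀ < m) (hdens : topDensity G < m)
    (x w : U) {c : ℝ} (hc : 0 ≤ c) :
    ∃ y : U, (∀ g h : G, dist (g.1 y) (h.1 x) = c + dist (g.1 x) (h.1 x)) ∧
      ∀ g h : G, dist (g.1 y) (h.1 w) = c + dist (g.1 x) (h.1 w) := by
  let a : Bool → U := fun i => if i then x else w
  obtain ⟨y, hy⟩ := hU.exists_dist_orbit_eq hm hdens a
    (fun i g => c + dist x (g.1 (a i)))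
    (fun i j g h => by
      linarith [dist_triangle x (h.1 (a j)) (g.1 (a i)), dist_comm (g.1 (a i)) (h.1 (a j))])
    (fun i j g h => by linarith [dist_triangle_left (g.1 (a i)) (h.1 (a j)) x])
  simp only [dist_apply_apply_eq_dist_inv_mul]
  exact ⟨y, fun g h => hy true (g⁻¹ * h), fun g h => hy false (g⁻¹ * h)⟩

/-- Two orbit pseudometrics are dominated by a third one. Pushing `w` away from the orbit of `x`
makes the two orbits so distant that the functions `g ↦ dist (g x) x` and `g ↦ dist (g w) w` can be
prescribed simultaneously. -/
theorem exists_dominating_pair (hU : IsUrysohnSpace m U) (hm : ℵ₀ < m) (hdens : topDensity G < m)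
    (hOB : HasPropertyOB G) (x w : U) :
    ∃ y : U, ∀ g h : G, dist (g.1 x) (h.1 x) ≤ dist (g.1 y) (h.1 y) ∧
      dist (g.1 w) (h.1 w) ≤ dist (g.1 y) (h.1 y) := by
  obtain ⟨D₁, hD₁⟩ := hOB _ (isLeftInvariantPseudometric_orbit x)
  obtain ⟨D₂, hD₂⟩ := hOB _ (isLeftInvariantPseudometric_orbit w)
  have hD₁0 : 0 ≤ D₁ := dist_nonneg.trans (hD₁ 1 1)
  have hD₂0 : 0 ≤ D₂ := dist_nonneg.trans (hD₂ 1 1)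
  -- The orbits of `x` and `w'` are at least `c` apart, which bounds the oscillation of each of the
  -- two prescribed functions.
  let c := D₁ + D₂
  obtain ⟨w', hw'w, hw'x⟩ :=
    hU.exists_dist_eq_add (G := G) hm hdens w x (c := c) (add_nonneg hD₁0 hD₂0)
  have hcross : ∀ g h : G, dist (g.1 w') (h.1 x) ≤ c + (D₂ + dist w x + D₁) := fun g h => by
    have h1 : dist (g.1 w) w ≤ D₂ := hD₂ g 1
    have h2 : dist x (h.1 x) ≤ D₁ := hD₁ 1 h
    rw [hw'x]
    linarith [dist_triangle4 (g.1 w) w x (h.1 x)]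
  -- Any two points of the union of the two orbits are at distance at most `2 * B`.
  let B := c + (D₂ + dist w x + D₁)
  have hx : ∀ g : G, dist (g.1 x) x ≤ D₁ := fun g => hD₁ g 1
  have hw : ∀ g : G, dist (g.1 w) w ≤ D₂ := fun g => hD₂ g 1
  have hd : 0 ≤ dist w x := dist_nonneg
  obtain ⟨y, hy⟩ := hU.exists_dist_orbit_eq hm hdens (fun i : Bool => if i then x else w')
    (fun i (g : G) => B + if i then dist (g.1 x) x else dist (g.1 w) w) (by
      rintro (_ | _) (_ | _) g h <;> simp only [if_true, Bool.false_eq_true, if_false]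
      · linarith [dist_triangle_right (g.1 w') (g.1 w) (h.1 w), dist_triangle (g.1 w) (h.1 w) w,
          hw'w g h, hw'w h h, dist_self (h.1 w), dist_triangle (g.1 w') (h.1 w') (h.1 w)]
      · linarith [hw g, dist_nonneg (x := h.1 x) (y := x), hw'x g h,
          dist_nonneg (x := g.1 w) (y := h.1 x)]
      · linarith [hx g, dist_nonneg (x := h.1 w) (y := w), hw'x h g,
          dist_nonneg (x := h.1 w) (y := g.1 x), dist_comm (g.1 x) (h.1 w')]
      · linarith [dist_triangle (g.1 x) (h.1 x) x]) (by
      intro i j g h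
      have hB : dist ((fun g : G => g.1 (if i then x else w')) g)
          ((fun g : G => g.1 (if j then x else w')) h) ≤ 2 * B := by
        rcases i with _ | _ <;> rcases j with _ | _ <;>
          simp only [if_true, Bool.false_eq_true, if_false]
        · linarith [dist_triangle_right (g.1 w') (h.1 w') (h.1 w), hw'w g h, hw'w h h,
            dist_self (h.1 w), hD₂ g h]
        · linarith [hcross g h]
        · linarith [hcross h g, dist_comm (g.1 x) (h.1 w')]
        · linarith [hD₁ g h]
      refine hB.trans ?_
      have hn : ∀ (i : Bool) (g : G), 0 ≤ if i then dist (g.1 x) x else dist (g.1 w) w := by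
        intro i g
        split_ifs <;> exact dist_nonneg
      linarith [hn i g, hn j h])
  refine ⟨y, fun g h => ⟨?_, ?_⟩⟩
  -- Compare the distances from `g y` and `h y` to the point `h x`, then to the point `h w'`.
  · have h1 := hy true (g⁻¹ * h)
    have h2 := hy true (h⁻¹ * h)
    simp only [if_true, ← dist_apply_apply_eq_dist_inv_mul] at h1 h2
    rw [dist_comm ((g⁻¹ * h).1 x), ← dist_apply_apply_eq_dist_inv_mul] at h1
    linarith [dist_triangle (g.1 y) (h.1 y) (h.1 x), dist_nonneg (x := (h⁻¹ * h).1 x) (y := x),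
      show dist ((h⁻¹ * h).1 x) x = 0 by simp]
  · have h1 := hy false (g⁻¹ * h)
    have h2 := hy false (h⁻¹ * h)
    simp only [Bool.false_eq_true, if_false, ← dist_apply_apply_eq_dist_inv_mul] at h1 h2
    rw [dist_comm ((g⁻¹ * h).1 w), ← dist_apply_apply_eq_dist_inv_mul] at h1
    linarith [dist_triangle (g.1 y) (h.1 y) (h.1 w'),
      show dist ((h⁻¹ * h).1 w) w = 0 by simp]

/-- The identity neighbourhoods of `G` come from single orbit pseudometrics. -/
theorem exists_dist_lt_imp_mem (hU : IsUrysohnSpace m U) (hm : ℵ₀ < m) (hdens : topDensity G < m)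
    (hOB : HasPropertyOB G) {V : Set G} (hV : V ∈ 𝓝 (1 : G)) :
    ∃ (x : U) (δ : ℝ), 0 < δ ∧ ∀ g h : G, dist (g.1 x) (h.1 x) < δ → g⁻¹ * h ∈ V := by
  have hne : Nonempty U := by
    obtain ⟨i, -⟩ := hU.universal PUnit
      ((topWeight_le_mk_mul_aleph0 _).trans (by simpa using hm.le))
    exact ⟨i ⟨⟩⟩
  have hind : IsInducing fun (g : G) (x : U) => g.1 x :=
    (IsInducing.mk rfl : IsInducing fun (g : U ≃ᵢ U) (x : U) => g x).comp IsInducing.subtypeVal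
  rw [hind.nhds_eq_comap, Filter.mem_comap] at hV
  obtain ⟨W, hW, hWV⟩ := hV
  rw [nhds_pi, Filter.mem_pi'] at hW
  obtain ⟨I, t, ht, hI⟩ := hW
  have key : ∀ J : Finset U, ∃ (x : U) (δ : ℝ), 0 < δ ∧
      ∀ g h : G, dist (g.1 x) (h.1 x) < δ → ∀ i ∈ J, (g⁻¹ * h).1 i ∈ t i := by
    intro J
    classical
    induction J using Finset.induction_on with
    | empty => exact ⟨hne.some, 1, one_pos, by simp⟩
    | insert i J _ ih =>
      obtain ⟨x, δ, hδ, hx⟩ := ih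
      obtain ⟨r, hr, hball⟩ := Metric.mem_nhds_iff.1 (ht i)
      obtain ⟨y, hy⟩ := hU.exists_dominating_pair hm hdens hOB x i
      refine ⟨y, min δ r, lt_min hδ hr, fun g h hgh j hj => ?_⟩
      rcases Finset.mem_insert.1 hj with rfl | hj
      · refine hball ?_
        rw [Metric.mem_ball, dist_comm]
        change dist j _ < r
        rw [← dist_apply_apply_eq_dist_inv_mul]
        exact ((hy g h).2.trans_lt hgh).trans_le (min_le_right _ _)
      · exact hx g h (((hy g h).1.trans_lt hgh).trans_le (min_le_left _ _)) j hj
  obtain ⟨x, δ, hδ, hx⟩ := key I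
  exact ⟨x, δ, hδ, fun g h hgh => hWV (hI fun i hi => hx g h hgh i hi)⟩

/-- A bounded antitone sequence of functions on `G`, all 1-Lipschitz for one orbit pseudometric, is
uniformly right equicontinuous: one point `z` encodes the whole sequence in its distances to
countably many orbits. Antitonicity is what makes the prescribed distances a Katětov function
although the orbits of `y k` and `y l` are only known to be `|k - l| * δ` apart. -/
theorem exists_nhds_forall_abs_sub_lt (hU : IsUrysohnSpace m U) (hm : ℵ₀ < m)
    (hdens : topDensity G < m) (hOB : HasPropertyOB G) (x : U) {δ : ℝ} (hδ : 0 ≤ δ)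
    (f : ℕ → G → ℝ) (hf : Antitone f) (h0 : ∀ k g, 0 ≤ f k g) (h1 : ∀ k g, f k g ≤ δ)
    (hlip : ∀ k g h, f k g - f k h ≤ dist (g.1 x) (h.1 x)) {η : ℝ} (hη : 0 < η) :
    ∃ V ∈ 𝓝 (1 : G), ∀ v ∈ V, ∀ k g, |f k (v * g) - f k g| < η := by
  obtain ⟨D, hD⟩ := hOB _ (isLeftInvariantPseudometric_orbit x)
  have hD0 : 0 ≤ D := dist_nonneg.trans (hD 1 1)
  choose y hy _ using fun k : ℕ =>
    hU.exists_dist_eq_add (G := G) hm hdens x x (c := k * δ) (by positivity)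
  have hlow : ∀ k l (g h : G),
      k * δ - l * δ + dist (g.1 x) (h.1 x) ≤ dist (g.1 (y k)) (h.1 (y l)) := fun k l g h => by
    linarith [hy k g h, hy l h h, dist_self (h.1 x),
      dist_triangle (g.1 (y k)) (h.1 (y l)) (h.1 x)]
  -- The summand `D` gives `dist a b ≤ φ a + φ b`, since a point of the orbit of `y k` and one
  -- of the orbit of `y l` are at distance at most `k * δ + l * δ + D`. For `k < l` the drop `(k - l) * δ ≤ -δ` absorbs the
  -- oscillation of `f`; for `l ≤ k` antitonicity reduces to the Lipschitz bound for `f l`.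
  obtain ⟨z, hz⟩ := hU.exists_dist_orbit_eq hm hdens y (fun k (g : G) => k * δ + D + f k g)
    (fun k l g h => by
      rcases le_or_gt l k with hlk | hkl
      · linarith [hlow k l g h, hf hlk g, hlip l g h]
      · have h2 : ((k : ℝ) + 1) * δ ≤ l * δ :=
          mul_le_mul_of_nonneg_right (by exact_mod_cast hkl) hδ
        linarith [h1 k g, h0 l h, dist_nonneg (x := g.1 (y k)) (y := h.1 (y l))])
    (fun k l g h => by
      linarith [hy k g h, hy l h h, dist_self (h.1 x), hD g h, h0 k g, h0 l h,
        dist_triangle_right (g.1 (y k)) (h.1 (y l)) (h.1 x)])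
  have hc : Continuous fun g : G => dist (g.1 z) z :=
    ((continuous_isometry_eval U z).comp continuous_subtype_val).dist continuous_const
  refine ⟨{v | dist (v.1 z) z < η}, (isOpen_lt hc continuous_const).mem_nhds ?_, ?_⟩
  · change dist z z < η
    rwa [dist_self]
  · intro v hv k g
    have e1 := hz k (v * g)
    have e2 : dist (v.1 z) ((v * g).1 (y k)) = k * δ + D + f k g :=
      (v.1.dist_eq z (g.1 (y k))).trans (hz k g)
    have hv' : dist (v.1 z) z < η := hv
    rw [abs_sub_lt_iff]
    constructor
    · linarith [dist_triangle_left z ((v * g).1 (y k)) (v.1 z)]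
    · linarith [dist_triangle (v.1 z) z ((v * g).1 (y k))]

end IsUrysohnSpace

end Orbits

/-! ### Truncated distances to a set -/

/-- The distance from `g` to the set `A`, for the pseudometric `ρ`, truncated at `δ`; it is `δ` if
`A` is empty. -/
noncomputable def truncatedInfDist {G : Type*} (ρ : G → G → ℝ) (δ : ℝ) (A : Set G) (g : G) : ℝ :=
  open Classical in ⨅ h : G, if h ∈ A then min δ (ρ g h) else δ

section TruncatedInfDist

variable {G : Type*} {ρ : G → G → ℝ} {δ : ℝ} {A B : Set G} {g h : G}

theorem truncatedInfDist_bddBelow (hρ : ∀ g h, 0 ≤ ρ g h) (hδ : 0 ≤ δ) (A : Set G) (g : G) :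
    open Classical in BddBelow (Set.range fun h : G => if h ∈ A then min δ (ρ g h) else δ) := by
  refine ⟨0, ?_⟩
  rintro _ ⟨h, rfl⟩
  dsimp only
  split_ifs
  exacts [le_min hδ (hρ g h), hδ]

theorem truncatedInfDist_nonneg (hρ : ∀ g h, 0 ≤ ρ g h) (hδ : 0 ≤ δ) (A : Set G) (g : G) :
    0 ≤ truncatedInfDist ρ δ A g := by
  refine Real.iInf_nonneg fun h => ?_
  split_ifs
  exacts [le_min hδ (hρ g h), hδ]

theorem truncatedInfDist_le (hρ : ∀ g h, 0 ≤ ρ g h) (hδ : 0 ≤ δ) (A : Set G) (g : G) :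
    truncatedInfDist ρ δ A g ≤ δ := by
  refine (ciInf_le (truncatedInfDist_bddBelow hρ hδ A g) g).trans ?_
  split_ifs
  exacts [min_le_left _ _, le_rfl]

theorem truncatedInfDist_anti (hρ : ∀ g h, 0 ≤ ρ g h) (hδ : 0 ≤ δ) (hAB : A ⊆ B) (g : G) :
    truncatedInfDist ρ δ B g ≤ truncatedInfDist ρ δ A g := by
  refine ciInf_mono (truncatedInfDist_bddBelow hρ hδ B g) fun h => ?_
  by_cases hA : h ∈ A
  · simp [hA, hAB hA]
  · rw [if_neg hA]
    split_ifs
    exacts [min_le_left _ _, le_rfl]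

theorem truncatedInfDist_sub_le (hρ : ∀ g h, 0 ≤ ρ g h)
    (htri : ∀ g h k, ρ g k ≤ ρ g h + ρ h k) (hδ : 0 ≤ δ) (A : Set G) (g h : G) :
    truncatedInfDist ρ δ A g - truncatedInfDist ρ δ A h ≤ ρ g h := by
  have : Nonempty G := ⟨g⟩
  suffices truncatedInfDist ρ δ A g - ρ g h ≤ truncatedInfDist ρ δ A h by linarith
  refine le_ciInf fun k => ?_
  rw [sub_le_iff_le_add]
  refine (ciInf_le (truncatedInfDist_bddBelow hρ hδ A g) k).trans ?_
  split_ifs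
  · rw [← min_add_add_right]
    exact min_le_min (by linarith [hρ g h]) (by linarith [htri g h k])
  · linarith [hρ g h]

theorem truncatedInfDist_eq_zero (hρ : ∀ g h, 0 ≤ ρ g h) (hself : ∀ g, ρ g g = 0) (hδ : 0 ≤ δ)
    (hg : g ∈ A) : truncatedInfDist ρ δ A g = 0 := by
  refine le_antisymm ?_ (truncatedInfDist_nonneg hρ hδ A g)
  refine (ciInf_le (truncatedInfDist_bddBelow hρ hδ A g) g).trans ?_
  simp [hg, hself]

theorem truncatedInfDist_eq (hρ : ∀ g h, 0 ≤ ρ g h) (hδ : 0 ≤ δ) (hg : ∀ h ∈ A, δ ≤ ρ g h) :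
    truncatedInfDist ρ δ A g = δ := by
  have : Nonempty G := ⟨g⟩
  refine le_antisymm (truncatedInfDist_le hρ hδ A g) (le_ciInf fun h => ?_)
  split_ifs with hA
  exacts [le_min le_rfl (hg h hA), le_rfl]

end TruncatedInfDist

/-! ### Left and right uniform continuity -/

section UniformContinuity

variable {G : Type*} [Group G] [TopologicalSpace G] {F : G → ℝ}

theorem LeftUniformlyContinuous.neg (hF : LeftUniformlyContinuous F) :
    LeftUniformlyContinuous fun g => -F g := by
  intro ε hε
  obtain ⟨V, hV, h⟩ := hF ε hε
  refine ⟨V, hV, fun x y hxy => ?_⟩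
  rw [neg_sub_neg, abs_sub_comm]
  exact h x y hxy

theorem LeftUniformlyContinuous.max_zero (hF : LeftUniformlyContinuous F) :
    LeftUniformlyContinuous fun g => max (F g) 0 := by
  intro ε hε
  obtain ⟨V, hV, h⟩ := hF ε hε
  exact ⟨V, hV, fun x y hxy => (abs_max_sub_max_le_abs _ _ _).trans_lt (h x y hxy)⟩

theorem RightUniformlyContinuous.sub {F' : G → ℝ} (hF : RightUniformlyContinuous F)
    (hF' : RightUniformlyContinuous F') : RightUniformlyContinuous fun g => F g - F' g := by
  intro ε hε
  obtain ⟨V, hV, h⟩ := hF (ε / 2) (half_pos hε)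
  obtain ⟨V', hV', h'⟩ := hF' (ε / 2) (half_pos hε)
  refine ⟨V ∩ V', Filter.inter_mem hV hV', fun x y hxy => ?_⟩
  have h1 := abs_lt.1 (h x y hxy.1)
  have h2 := abs_lt.1 (h' x y hxy.2)
  rw [abs_lt]
  constructor <;> linarith [h1.1, h1.2, h2.1, h2.2]

theorem LeftUniformlyContinuous.right_of_forall_nonneg
    (h : ∀ F : G → ℝ, (∀ g, 0 ≤ F g) → LeftUniformlyContinuous F → RightUniformlyContinuous F)
    (hF : LeftUniformlyContinuous F) : RightUniformlyContinuous F := by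
  have h1 := (h _ (fun _ => le_max_right _ _) hF.max_zero).sub
    (h _ (fun _ => le_max_right _ _) hF.neg.max_zero)
  convert h1 using 2 with g
  rcases le_total (F g) 0 with h0 | h0 <;> simp [h0]

theorem RightUniformlyContinuous.comp_inv (hF : RightUniformlyContinuous F) :
    LeftUniformlyContinuous fun g => F g⁻¹ := by
  intro ε hε
  obtain ⟨V, hV, h⟩ := hF ε hε
  exact ⟨V, hV, fun x y hxy => h _ _ (by rwa [inv_inv])⟩

/-- Inversion exchanges the two uniform structures, so one implication for all functions gives the
other one. -/
theorem isFSIN_of_forall_left_imp_right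
    (h : ∀ F : G → ℝ, LeftUniformlyContinuous F → RightUniformlyContinuous F) : IsFSIN G := by
  refine fun F => ⟨h F, fun hF => ?_⟩
  simpa only [inv_inv] using (h _ hF.comp_inv).comp_inv

end UniformContinuity

/-- The level sets `{F < k ε}` are separated from `{(k + 1) ε ≤ F}`, uniformly in `k`, for an orbit
pseudometric, so the truncated distances to them control the growth of `F` under left
translations. -/
theorem IsUrysohnSpace.rightUniformlyContinuous_of_nonneg {m : Cardinal.{u}} {U : Type u}
    [MetricSpace U] {G : Subgroup (U ≃ᵢ U)} (hU : IsUrysohnSpace m U) (hm : ℵ₀ < m)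
    (hdens : topDensity G < m) (hOB : HasPropertyOB G) {F : G → ℝ} (hF0 : ∀ g, 0 ≤ F g)
    (hF : LeftUniformlyContinuous F) : RightUniformlyContinuous F := by
  intro ε' hε'
  obtain ⟨ε, hε, rfl⟩ : ∃ ε, 0 < ε ∧ ε' = 2 * ε := ⟨ε' / 2, half_pos hε', by ring⟩
  obtain ⟨W, hW, hWF⟩ := hF ε hε
  obtain ⟨x, δ, hδ, hx⟩ := hU.exists_dist_lt_imp_mem hm hdens hOB hW
  let ρ : G → G → ℝ := fun g h => dist (g.1 x) (h.1 x)
  have hρ : ∀ g h, 0 ≤ ρ g h := fun _ _ => dist_nonneg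
  let A : ℕ → Set G := fun k => {g | F g < k * ε}
  have hA : Monotone A := fun k l hkl g (hg : F g < k * ε) =>
    hg.trans_le (mul_le_mul_of_nonneg_right (by exact_mod_cast hkl) hε.le)
  obtain ⟨V, hV, hVf⟩ := hU.exists_nhds_forall_abs_sub_lt hm hdens hOB x hδ.le
    (fun k => truncatedInfDist ρ δ (A k))
    (fun k l hkl => truncatedInfDist_anti hρ hδ.le (hA hkl))
    (fun k => truncatedInfDist_nonneg hρ hδ.le (A k))
    (fun k => truncatedInfDist_le hρ hδ.le (A k))
    (fun k => truncatedInfDist_sub_le hρ (fun _ _ _ => dist_triangle _ _ _) hδ.le (A k)) hδ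
  have key : ∀ v ∈ V, ∀ g, F (v * g) < F g + 2 * ε := by
    intro v hv g
    -- `k` is the least index with `F g < k * ε`, as `F` is nonnegative.
    let k := ⌊F g / ε⌋₊ + 1
    have hgk : F g < k * ε := by
      rw [← div_lt_iff₀ hε]
      exact_mod_cast Nat.lt_floor_add_one (F g / ε)
    have hkg : (k : ℝ) * ε ≤ F g + ε := by
      have := (le_div_iff₀ hε).1 (Nat.floor_le (div_nonneg (hF0 g) hε.le))
      push_cast [k]
      linarith
    by_contra! hcon
    have hvg : truncatedInfDist ρ δ (A k) (v * g) = δ := by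
      refine truncatedInfDist_eq hρ hδ.le fun h (hh : F h < k * ε) => ?_
      by_contra! hlt
      linarith [(abs_lt.1 (hWF _ _ (hx _ _ hlt))).2]
    have hg : truncatedInfDist ρ δ (A k) g = 0 :=
      truncatedInfDist_eq_zero hρ (fun _ => dist_self _) hδ.le hgk
    have h1 := hVf v hv k g
    rw [hvg, hg, sub_zero, abs_of_pos hδ] at h1
    exact h1.false
  refine ⟨V ∩ V⁻¹, Filter.inter_mem hV (inv_mem_nhds_one G hV), fun a b hab => ?_⟩
  have h1 := key _ hab.1 b
  have h2 := key _ hab.2 a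
  rw [inv_mul_cancel_right] at h1
  rw [mul_inv_rev, inv_inv, inv_mul_cancel_right] at h2
  rw [abs_sub_lt_iff]
  constructor <;> linarith

theorem mainTheorem7 (m : Cardinal.{u}) (hm : ℵ₀ < m)
    (hsup : IsLUB {c : Cardinal.{u} | ∃ n : Cardinal.{u}, n < m ∧ c = m ^ n} m)
    (U : Type u) [MetricSpace U] (hU : IsUrysohnSpace m U)
    (G : Subgroup (U ≃ᵢ U)) (hdens : topDensity G < m) (hOB : HasPropertyOB G) :
    IsFSIN G :=
  isFSIN_of_forall_left_imp_right fun _ hF =>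
    LeftUniformlyContinuous.right_of_forall_nonneg
      (fun _ hF0 hF' => hU.rightUniformlyContinuous_of_nonneg hm hdens hOB hF0 hF') hF
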